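/- **Setting.** Let $\mathcal G=(\mathbb V,\mathbb E)$ be a finite simple graph with arbitrarily oriented edges and incidence matrix $\mathcal E_{\mathcal G}\in\mathbb R^{\mathbb V\times\mathbb E}$ ($+1$ at the tail $i$ and $-1$ at the head $j$ of $e=(i,j)$). Each vertex $i$ carries a SISO agent $\Sigma_i:\ \dot x_i=f_i(x_i,u_i),\ y_i=h_i(x_i)$, and each edge $e$ a SISO controller $\Pi_e:\ \dot\eta_e=\phi_e(\eta_e,\zeta_e),\ \mu_e=\psi_e(\eta_e,\zeta_e)$, with finite-dimensional states. For a bias $\mathrm w\in\mathbb R^{\mathbb E}$ and a subgraph $\mathcal H=(\mathbb V,\mathbb E_{\mathcal H})$ of $\mathcal G$, the network with interaction protocol $(\Pi,\mathrm w)$ and functioning edges $\mathbb E_{\mathcal H}$ is closed by $\zeta=\mathcal E_{\mathcal H}^\top y$, $u=-\mathcal E_{\mathcal H}(\mu+P_{\mathcal H}\mathrm w)$, where $P_{\mathcal H}$ deletes the entries of the edges absent from $\mathcal H$. Faults are described by a switching signal $\varsigma$ on $[0,\infty)$ with values in the subgraphs of $\mathcal G$ that have at least one edge, non-increasing (faulty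 edges remain faulty); $\varsigma(t)$ gives the functioning edges at time $t$. In a run, the states are continuous and satisfy the differential equations at all times at which $\varsigma$ does not switch. The steady-state relation of a SISO system is the set of pairs (constant input $\mathrm u$, output $\mathrm y$ at a rest point for this input). A SISO system with output $y(t)$ and input $u(t)$ is passive (output-strictly passive) with respect to a steady-state pair $(\mathrm u,\mathrm y)$ if there are a differentiable positive semi-definite storage function $S$ of the state and some $\rho\ge0$ ($\rho>0$) with $\frac{d}{dt}S\le-\rho(y(t)-\mathrm y)^2+(y(t)-\mathrm y)(u(t)-\mathrm u)$ along all trajectories. It is (output-strictly) MEIP if it is (output-strictly) passive with respect to all of its steady-state pairs and its steady-state relation is maximally monotone. **Assumption 1.** The agents are MEIP and the controllers are output-strictly MEIP, or vice versa; the inverse steady-state relations $k_i^{-1}$ of the agents and the steady-state relations $\gamma_e$ of the controllers are $C^1$ functions on $\mathbb R$; and $\frac{d k_i^{-1}}{d\mathrm y_i}>0$ everywhere. **Convergence assertion.** A monitor measures the network while it runs and, at each time, decides from the measurements made so far whether to stop and declare "no". It is a convergence assertion algorithm for the network with protocol $(\Pi,\mathrm w)$ and the conjectured limit $\mathrm y^\star$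 if in every run, under any switching signal as above, it declares "no" at some finite time if and only if the output $y(t)$ does not converge to $\mathrm y^\star$. **Algorithm 1.** (1) Choose controllers $\Pi$ which satisfy, with the agents, Assumption 1 and solve the synthesis problem for $\mathrm y^\star\in\mathbb R^{\mathbb V}$, i.e. $\mathrm y^\star$ is a steady-state output of the faultless closed loop without bias, and the output of this closed loop converges to $\mathrm y^\star$ along every trajectory. (2) Take a basis $b_1,\dots,b_k$ of $\ker\mathcal E_{\mathcal G}$. (3) Draw a nondegenerate Gaussian vector $\alpha\in\mathbb R^k$, and put $\mathrm w=\sum_i\alpha_ib_i$. (4) Run the network with the protocol $(\Pi,\mathrm w)$, together with a convergence assertion algorithm $\mathscr A$ for it with limit $\mathrm y^\star$, and declare a fault when $\mathscr A$ declares "no". **Theorem (Network Fault Detection).** Let $\mathcal G$ be $2$-connected (connected, and still connected after removal of any one vertex), and suppose that the agents and the controllers chosen in step (1) satisfy Assumption 1. Then, with probability $1$ with respect to $\alpha$, the outcome of Algorithm 1 solves the network fault detection problem, for every convergence assertion algorithm $\mathscr A$ used in step (4): i) if no faults occur ($\varsigma(t)=\mathcal G$ for all $t$), the closed loop converges to the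 steady-state output $\mathrm y^\star$, and no fault is ever declared; ii) if faults occur ($\varsigma(t)\ne\mathcal G$ for some $t$), however many and at whatever times, a fault is declared at some finite time. -/

import Mathlib

open Set Filter Topology MeasureTheory ProbabilityTheory

/-! ### SISO systems, steady states and passivity -/

/-- A SISO dynamical system `ẋ = f(x, u)`, `y = h(x, u)` with state space `ℝ^dim`
(a static nonlinearity is a system with `dim = 0`). -/
structure SISOSystem where
  dim : ℕ
  f : EuclideanSpace ℝ (Fin dim) → ℝ → EuclideanSpace ℝ (Fin dim)
  h : EuclideanSpace ℝ (Fin dim) → ℝ → ℝ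

namespace SISOSystem

/-- The state space of a system. -/
abbrev State (S : SISOSystem) : Type := EuclideanSpace ℝ (Fin S.dim)

/-- The steady-state input-output relation: all pairs `(u, y)` such that, for the constant input
`u`, the system has a rest point whose output is `y`. -/
def rel (S : SISOSystem) : Set (ℝ × ℝ) :=
  {p | ∃ x : S.State, S.f x p.1 = 0 ∧ S.h x p.1 = p.2}

/-- Passivity with respect to the pair `(u, y)` with the constant `ρ`: there is a differentiable
positive semi-definite storage function `W` such that
`d/dt W(x(t)) ≤ -ρ (y(t) - y)² + (y(t) - y) (u(t) - u)` along every trajectory. -/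
def PassiveWith (S : SISOSystem) (ρ u y : ℝ) : Prop :=
  ∃ W : S.State → ℝ, Differentiable ℝ W ∧ (∀ x, 0 ≤ W x) ∧
    (∃ x₀, S.f x₀ u = 0 ∧ S.h x₀ u = y ∧ W x₀ = 0) ∧
    ∀ (a b : ℝ) (x : ℝ → S.State) (v : ℝ → ℝ),
      (∀ t ∈ Ioo a b, HasDerivAt x (S.f (x t) (v t)) t) →
      ∀ t ∈ Ioo a b, deriv (fun s => W (x s)) t ≤
        -ρ * (S.h (x t) (v t) - y) ^ 2 + (S.h (x t) (v t) - y) * (v t - u)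

/-- The system is passive with respect to the pair `(u, y)`. -/
def IsPassive (S : SISOSystem) (u y : ℝ) : Prop := ∃ ρ, 0 ≤ ρ ∧ S.PassiveWith ρ u y

/-- The system is output-strictly passive with respect to the pair `(u, y)`. -/
def IsOutputStrictlyPassive (S : SISOSystem) (u y : ℝ) : Prop := ∃ ρ, 0 < ρ ∧ S.PassiveWith ρ u y

end SISOSystem

/-- A monotone relation on `ℝ`. -/
def IsMonotoneRel (r : Set (ℝ × ℝ)) : Prop :=
  ∀ p ∈ r, ∀ q ∈ r, 0 ≤ (p.1 - q.1) * (p.2 - q.2)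

namespace SISOSystem

/-- Maximal equilibrium-independent passivity. -/
def IsMEIP (S : SISOSystem) : Prop :=
  (∀ u y, (u, y) ∈ S.rel → S.IsPassive u y) ∧ Maximal IsMonotoneRel S.rel

/-- Output-strict maximal equilibrium-independent passivity. -/
def IsOutputStrictlyMEIP (S : SISOSystem) : Prop :=
  (∀ u y, (u, y) ∈ S.rel → S.IsOutputStrictlyPassive u y) ∧ Maximal IsMonotoneRel S.rel

end SISOSystem

/-- An agent `ẋ = f(x, u)`, `y = h(x)`: a SISO system without feedthrough. -/
structure Agent where
  dim : ℕ
  f : EuclideanSpace ℝ (Fin dim) → ℝ → EuclideanSpace ℝ (Fin dim)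
  h : EuclideanSpace ℝ (Fin dim) → ℝ

namespace Agent

/-- The state space of an agent. -/
abbrev State (A : Agent) : Type := EuclideanSpace ℝ (Fin A.dim)

/-- The agent as a SISO system. -/
def toSISO (A : Agent) : SISOSystem := ⟨A.dim, A.f, fun x _ => A.h x⟩

end Agent

/-! ### Diffusively-coupled networks -/

/-- A diffusively-coupled network `(G, Σ, Π)`: an agent at each vertex, a controller
on each edge, and an arbitrary orientation `e = (src e, tgt e)` of each edge. -/
structure DiffusiveNetwork {V : Type*} (G : SimpleGraph V) where
  src : G.edgeSet → V
  tgt : G.edgeSet → V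
  edge_eq : ∀ e : G.edgeSet, s(src e, tgt e) = (e : Sym2 V)
  agent : V → Agent
  ctrl : G.edgeSet → SISOSystem

/-- Deletion (replacement by `0`) of the entries on the edges absent from `H`. For a subgraph `H`
of `G` with incidence matrix `E_H` and coordinate projection `P_H`, one has
`E_H (P_H v) = E_G (maskEdges H v)`. -/
noncomputable def maskEdges {V : Type*} {G : SimpleGraph V} (H : SimpleGraph V)
    (v : G.edgeSet → ℝ) : G.edgeSet → ℝ := by
  classical exact fun e => if (e : Sym2 V) ∈ H.edgeSet then v e else 0

namespace DiffusiveNetwork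

variable {V : Type*} {G : SimpleGraph V}

/-- The incidence matrix of `G`: the column of `e = (i, j)` is `+1` at `i`, `-1` at `j`,
and `0` elsewhere. -/
def incidence [DecidableEq V] (N : DiffusiveNetwork G) : Matrix V G.edgeSet ℝ :=
  fun i e => if i = N.src e then 1 else if i = N.tgt e then -1 else 0

/-- The states of all agents. -/
abbrev AgentState (N : DiffusiveNetwork G) : Type _ := (i : V) → (N.agent i).State

/-- The states of all controllers. -/
abbrev CtrlState (N : DiffusiveNetwork G) : Type _ := (e : G.edgeSet) → (N.ctrl e).State

/-- The stacked agent output `y = h(x)`. -/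
def output (N : DiffusiveNetwork G) (x : N.AgentState) : V → ℝ := fun i => (N.agent i).h (x i)

/-- The stacked controller input `ζ = Eᵀ y`. -/
def ctrlInput [Fintype V] [DecidableEq V] (N : DiffusiveNetwork G) (x : N.AgentState) :
    G.edgeSet → ℝ := N.incidence.transpose.mulVec (N.output x)

/-- The stacked controller output `μ = ψ(η, ζ)`. -/
def ctrlOutput [Fintype V] [DecidableEq V] (N : DiffusiveNetwork G) (x : N.AgentState)
    (η : N.CtrlState) : G.edgeSet → ℝ := fun e => (N.ctrl e).h (η e) (N.ctrlInput x e)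

/-- The stacked agent input under the interaction protocol `(Π, w)` when the functioning edges are
those of the subgraph `H`: `u = -E_H (μ + P_H w)`. -/
noncomputable def agentInput [Fintype V] [DecidableEq V] [Fintype G.edgeSet]
    (N : DiffusiveNetwork G) (w : G.edgeSet → ℝ) (H : SimpleGraph V) (x : N.AgentState)
    (η : N.CtrlState) : V → ℝ :=
  -(N.incidence.mulVec (maskEdges H (N.ctrlOutput x η + w)))

/-- `(x, η)` is a trajectory on `[0, ∞)` of the closed loop with interaction protocol `(Π, w)` in
which the functioning edges at time `t` are those of `ς t`. The states are continuous and obey the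
differential equations at all times at which `ς` does not switch. A malfunctioning controller has
no effect on the network, and nothing is required of its state. -/
structure IsTrajectory [Fintype V] [DecidableEq V] [Fintype G.edgeSet]
    (N : DiffusiveNetwork G) (w : G.edgeSet → ℝ) (ς : ℝ → SimpleGraph V)
    (x : ℝ → N.AgentState) (η : ℝ → N.CtrlState) : Prop where
  agent_continuous : ∀ i, ContinuousOn (fun t => x t i) (Ici 0)
  agent_ode : ∀ i t, 0 < t → (∀ᶠ s in 𝓝 t, ς s = ς t) →
    HasDerivAt (fun s => x s i)
      ((N.agent i).f (x t i) (N.agentInput w (ς t) (x t) (η t) i)) t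
  ctrl_continuous : ∀ e : G.edgeSet,
    ContinuousOn (fun t => η t e) {t | 0 ≤ t ∧ (e : Sym2 V) ∈ (ς t).edgeSet}
  ctrl_ode : ∀ (e : G.edgeSet) (t : ℝ), 0 < t → (∀ᶠ s in 𝓝 t, ς s = ς t) →
    (e : Sym2 V) ∈ (ς t).edgeSet →
    HasDerivAt (fun s => η s e) ((N.ctrl e).f (η t e) (N.ctrlInput (x t) e)) t

/-- `y` is a steady-state output of the faultless closed loop with interaction protocol
`(Π, w)`. -/
def IsSteadyOutput [Fintype V] [DecidableEq V] [Fintype G.edgeSet]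
    (N : DiffusiveNetwork G) (w : G.edgeSet → ℝ) (y : V → ℝ) : Prop :=
  ∃ (x : N.AgentState) (η : N.CtrlState), N.output x = y ∧
    (∀ i, (N.agent i).f (x i) (N.agentInput w G x η i) = 0) ∧
    (∀ e, (N.ctrl e).f (η e) (N.ctrlInput x e) = 0)

/-- The faultless closed loop with interaction protocol `(Π, w)` converges to the steady-state
output `y`: this is a steady-state output, and every trajectory has output tending to `y`. -/
def ConvergesTo [Fintype V] [DecidableEq V] [Fintype G.edgeSet]
    (N : DiffusiveNetwork G) (w : G.edgeSet → ℝ) (y : V → ℝ) : Prop :=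
  N.IsSteadyOutput w y ∧
    ∀ (x : ℝ → N.AgentState) (η : ℝ → N.CtrlState), N.IsTrajectory w (fun _ => G) x η →
      Tendsto (fun t => N.output (x t)) atTop (𝓝 y)

/-- The controllers solve the synthesis problem with desired output `y`: without any bias, they
force the closed loop to converge to `y`. -/
def SolvesSynthesis [Fintype V] [DecidableEq V] [Fintype G.edgeSet]
    (N : DiffusiveNetwork G) (y : V → ℝ) : Prop := N.ConvergesTo 0 y

/-- The standing assumption on the agents and the controllers: the agents are MEIP and the
controllers output-strictly MEIP, or vice versa; the inverse steady-state relations `k_i⁻¹` of the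
agents and the steady-state relations `γ_e` of the controllers are `C¹` functions on `ℝ`; and the
functions `k_i⁻¹` have positive derivative everywhere. -/
structure StandingAssumption (N : DiffusiveNetwork G) : Prop where
  meip : ((∀ i, (N.agent i).toSISO.IsMEIP) ∧ ∀ e, (N.ctrl e).IsOutputStrictlyMEIP) ∨
    ((∀ i, (N.agent i).toSISO.IsOutputStrictlyMEIP) ∧ ∀ e, (N.ctrl e).IsMEIP)
  agent_rel : ∀ i, ∃ κ : ℝ → ℝ, ContDiff ℝ 1 κ ∧ (∀ y, 0 < deriv κ y) ∧
    (N.agent i).toSISO.rel = {p | p.1 = κ p.2}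
  ctrl_rel : ∀ e, ∃ γ : ℝ → ℝ, ContDiff ℝ 1 γ ∧ (N.ctrl e).rel = {p | p.2 = γ p.1}

end DiffusiveNetwork

/-! ### Faults and fault monitoring -/

/-- A switching signal on `[0, ∞)` with values in the nonempty (spanning) subgraphs of `G` that is
non-increasing, i.e. faulty edges remain faulty. -/
structure IsFaultSignal {V : Type*} (G : SimpleGraph V) (ς : ℝ → SimpleGraph V) : Prop where
  subgraph : ∀ t, 0 ≤ t → ς t ≤ G
  nonempty : ∀ t, 0 ≤ t → ς t ≠ ⊥
  antitone : AntitoneOn ς (Ici 0)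

/-- An on-line monitor which, from a measured signal `m` with values in `M`, decides at each time
`t` whether to stop and declare "no", on the basis of the measurements up to time `t`. -/
structure Monitor (M : Type*) where
  declares : (ℝ → M) → ℝ → Prop
  causal : ∀ (m m' : ℝ → M) (t : ℝ), (∀ s ∈ Icc 0 t, m s = m' s) →
    (declares m t ↔ declares m' t)

/-- The monitor stops and declares "no" at some time. -/
def Monitor.Stops {M : Type*} (A : Monitor M) (m : ℝ → M) : Prop := ∃ t, 0 ≤ t ∧ A.declares m t

namespace DiffusiveNetwork

variable {V : Type*} {G : SimpleGraph V}

/-- `A` is a convergence assertion algorithm for the network with interaction protocol `(Π, w)` and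
conjectured limit `y`, with measurements `meas` of the states: in every run of the network, with or
without faults, it stops and declares "no" if and only if the output does not converge to `y`. -/
def IsConvergenceAssertion [Fintype V] [DecidableEq V] [Fintype G.edgeSet]
    (N : DiffusiveNetwork G) (w : G.edgeSet → ℝ) (y : V → ℝ) {M : Type*}
    (meas : N.AgentState → N.CtrlState → M) (A : Monitor M) : Prop :=
  ∀ (ς : ℝ → SimpleGraph V) (x : ℝ → N.AgentState) (η : ℝ → N.CtrlState),
    IsFaultSignal G ς → N.IsTrajectory w ς x η →
    (A.Stops (fun t => meas (x t) (η t)) ↔ ¬ Tendsto (fun t => N.output (x t)) atTop (𝓝 y))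

/-- The interaction protocol `(Π, w)` together with the monitor `A` (whose "no" is the declaration
of a fault) solves the network fault detection problem with desired output `y`. -/
structure SolvesFaultDetection [Fintype V] [DecidableEq V] [Fintype G.edgeSet]
    (N : DiffusiveNetwork G) (w : G.edgeSet → ℝ) (y : V → ℝ) {M : Type*}
    (meas : N.AgentState → N.CtrlState → M) (A : Monitor M) : Prop where
  /-- Without faults, the closed loop converges to `y`. -/
  converges : N.ConvergesTo w y
  /-- Without faults, no fault is ever declared. -/
  no_false_alarm : ∀ (ς : ℝ → SimpleGraph V) (x : ℝ → N.AgentState) (η : ℝ → N.CtrlState),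
    IsFaultSignal G ς → N.IsTrajectory w ς x η → (∀ t, 0 ≤ t → ς t = G) →
    ¬ A.Stops (fun t => meas (x t) (η t))
  /-- If faults occur, however many and whenever, a fault is declared. -/
  detects : ∀ (ς : ℝ → SimpleGraph V) (x : ℝ → N.AgentState) (η : ℝ → N.CtrlState),
    IsFaultSignal G ς → N.IsTrajectory w ς x η → (∃ t, 0 ≤ t ∧ ς t ≠ G) →
    A.Stops (fun t => meas (x t) (η t))

end DiffusiveNetwork

/-- A 2-connected graph: connected, and still connected after removal of any one vertex
(the empty graph that is left of a one-vertex graph is admitted). -/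
def IsTwoConnected {V : Type*} (G : SimpleGraph V) : Prop :=
  G.Connected ∧ ∀ v : V, (G.induce {v}ᶜ).Preconnected

/-!
The bias `w` is a circulation, `E_G w = 0`, so it does not act on the faultless network, which
therefore converges to `ystar` as it does without bias. After a fault, the non-increasing signal is
eventually constant, equal to a nonempty proper subgraph `H` of `G`, and it has to be shown that,
for almost every bias, no run on `H` has an output that converges to `ystar`. The convergence
assertion then declares "no".

Convergence to `ystar` would make `ystar` a steady state on `H`. No steady state on `H` need exist
beforehand, so there is none to which the storage functions could be attached. Instead, they are
attached to an arbitrary output `y'` and to `Eᵀ y'`, which belong to steady-state pairs of the single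
systems, because `k⁻¹` and `γ` are defined on all of `ℝ`. In the sum of the dissipation inequalities
the controller outputs cancel, and the total storage decreases at least at the rate
`(y - y') ⬝ᵥ R(y')`, where `R(y') = k⁻¹(y') + E_H (γ(Eᵀ y') + P_H w)` is the residual of the
steady-state equation on `H` (`supply_eq_residual`). As storage is nonnegative and `y` tends to
`ystar`, it follows that `(ystar - y') ⬝ᵥ R(y') ≤ 0` for all `y'`, and Minty's trick with the
continuity of `R` gives `R(ystar) = 0` (`residual_eq_zero_of_tendsto`).

Subtraction of the steady-state equation on `G` leaves `E_H (γ* + P_H w) = E_G γ*` with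
`γ* = γ(Eᵀ ystar)`. This is an affine condition on the coefficients `α` of `w`. It is not satisfied
identically, because some circulation loses its flow conservation when it is restricted to `H`: by
connectedness, some vertex `v` lies on an edge of `H` and on an edge outside `H`, and by
`2`-connectedness these are joined to a closed walk that visits `v` only once
(`exists_circulation_mask_ne_zero`). So each of the finitely many `H` excludes a null set of `α`
(`ae_incidence_mulVec_mask_ne`).
-/

/-! ### Storage functions and Minty's trick -/

section Dissipation

/-- A nonnegative function whose derivative is bounded above by a convergent function cannot have
a negative limiting bound, since it would tend to `-∞`. -/
theorem limit_nonneg_of_hasDerivAt_le_of_nonneg {W W' g : ℝ → ℝ} {T l : ℝ}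
    (hW : ∀ t, T < t → HasDerivAt W (W' t) t) (hle : ∀ t, T < t → W' t ≤ g t)
    (hg : Tendsto g atTop (𝓝 l)) (hpos : ∀ t, 0 ≤ W t) : 0 ≤ l := by
  by_contra! hl
  obtain ⟨T₁, hT₁⟩ := eventually_atTop.1 (hg.eventually_le_const (show l < l / 2 by linarith))
  set S := max T T₁ + 1 with hS
  have hST : T < S := by have := le_max_left T T₁; linarith
  have hST₁ : T₁ ≤ S := by have := le_max_right T T₁; linarith
  have hdiff : ∀ t, S ≤ t → HasDerivAt W (W' t) t := fun t ht => hW t (by linarith)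
  have hbound : ∀ t, S ≤ t → W t - W S ≤ l / 2 * (t - S) := by
    intro t ht
    refine (convex_Ici S).image_sub_le_mul_sub_of_deriv_le
      (fun s hs => (hdiff s hs).continuousAt.continuousWithinAt)
      (fun s hs => ?_) (fun s hs => ?_) S self_mem_Ici t ht ht
    · exact (hdiff s (interior_subset hs)).differentiableAt.differentiableWithinAt
    · have hs' : S ≤ s := interior_subset hs
      rw [(hdiff s hs').deriv]
      exact (hle s (by linarith)).trans (hT₁ s (by linarith))
  -- at this time the linear upper bound takes the value `-1`
  have hlt : 0 ≤ (W S + 1) * (2 / -l) :=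
    mul_nonneg (by linarith [hpos S]) (div_nonneg (by norm_num) (by linarith))
  have h := hbound (S + (W S + 1) * (2 / -l)) (by linarith)
  have h' : l / 2 * (S + (W S + 1) * (2 / -l) - S) = -(W S + 1) := by
    field_simp [hl.ne]
    ring
  linarith [hpos (S + (W S + 1) * (2 / -l))]

/-- Minty's trick for a continuous map on a finite-dimensional space. -/
theorem eq_zero_of_forall_sub_dotProduct_nonpos {V : Type*} [Fintype V] {R : (V → ℝ) → V → ℝ}
    (hR : Continuous R) (y : V → ℝ) (h : ∀ y', (y - y') ⬝ᵥ R y' ≤ 0) : R y = 0 := by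
  have key : R y ⬝ᵥ R y ≤ 0 := by
    -- test with `y' = y - ε R(y)` and let `ε` tend to `0` from the right
    have hlim : Tendsto (fun ε : ℝ => R y ⬝ᵥ R (y - ε • R y)) (𝓝[>] 0) (𝓝 (R y ⬝ᵥ R y)) := by
      have hc : Continuous fun ε : ℝ => R y ⬝ᵥ R (y - ε • R y) := by
        simp only [dotProduct]
        fun_prop
      simpa using (hc.tendsto 0).mono_left nhdsWithin_le_nhds
    refine le_of_tendsto hlim (eventually_nhdsWithin_of_forall fun ε (hε : 0 < ε) => ?_)
    have := h (y - ε • R y)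
    rw [sub_sub_cancel, smul_dotProduct, smul_eq_mul] at this
    exact nonpos_of_mul_nonpos_right this hε
  exact dotProduct_self_eq_zero.1 (le_antisymm key (Finset.sum_nonneg fun _ _ => mul_self_nonneg _))

end Dissipation

namespace SISOSystem

/-- The dissipation inequality of a passive system along a trajectory on a half-line. -/
theorem IsPassive.exists_storage {S : SISOSystem} {u y : ℝ} (h : S.IsPassive u y) :
    ∃ W : S.State → ℝ, (∀ x, 0 ≤ W x) ∧ ∀ (T : ℝ) (x : ℝ → S.State) (v : ℝ → ℝ),
      (∀ t, T < t → HasDerivAt x (S.f (x t) (v t)) t) → ∀ t, T < t →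
        ∃ d, HasDerivAt (fun s => W (x s)) d t ∧ d ≤ (S.h (x t) (v t) - y) * (v t - u) := by
  obtain ⟨ρ, hρ, W, hWd, hW, -, hle⟩ := h
  refine ⟨W, hW, fun T x v hx t ht => ⟨_, DifferentiableAt.hasDerivAt ?_,
    (hle T (t + 1) x v (fun s hs => hx s hs.1) t ⟨ht, by linarith⟩).trans ?_⟩⟩
  · exact (hWd (x t)).comp t (hx t ht).differentiableAt
  · nlinarith [mul_nonneg hρ (sq_nonneg (S.h (x t) (v t) - y))]

theorem IsOutputStrictlyPassive.isPassive {S : SISOSystem} {u y : ℝ}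
    (h : S.IsOutputStrictlyPassive u y) : S.IsPassive u y := by
  obtain ⟨ρ, hρ, h⟩ := h
  exact ⟨ρ, hρ.le, h⟩

end SISOSystem

/-! ### Deletion of edges -/

section MaskEdges

variable {V : Type*} {G : SimpleGraph V}

theorem maskEdges_of_mem {H : SimpleGraph V} (v : G.edgeSet → ℝ) {e : G.edgeSet}
    (he : (e : Sym2 V) ∈ H.edgeSet) : maskEdges H v e = v e := by
  simp [maskEdges, he]

theorem maskEdges_of_notMem {H : SimpleGraph V} (v : G.edgeSet → ℝ) {e : G.edgeSet}
    (he : (e : Sym2 V) ∉ H.edgeSet) : maskEdges H v e = 0 := by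
  simp [maskEdges, he]

theorem maskEdges_self (v : G.edgeSet → ℝ) : maskEdges G v = v :=
  funext fun e => maskEdges_of_mem v e.2

theorem maskEdges_add (H : SimpleGraph V) (v w : G.edgeSet → ℝ) :
    maskEdges H (v + w) = maskEdges H v + maskEdges H w := by
  ext e
  by_cases he : (e : Sym2 V) ∈ H.edgeSet <;> simp [maskEdges, he]

theorem maskEdges_smul (H : SimpleGraph V) (c : ℝ) (v : G.edgeSet → ℝ) :
    maskEdges H (c • v) = c • maskEdges H v := by
  ext e
  by_cases he : (e : Sym2 V) ∈ H.edgeSet <;> simp [maskEdges, he]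

theorem continuous_maskEdges (H : SimpleGraph V) :
    Continuous (maskEdges H : (G.edgeSet → ℝ) → G.edgeSet → ℝ) := by
  refine continuous_pi fun e => ?_
  by_cases he : (e : Sym2 V) ∈ H.edgeSet
  · simpa only [maskEdges_of_mem _ he] using continuous_apply e
  · simpa only [maskEdges_of_notMem _ he] using continuous_const

end MaskEdges

namespace SimpleGraph

variable {V : Type*} {G H : SimpleGraph V}

/-- In a connected graph, the edges of a nonempty proper subgraph meet the other edges at some
vertex. -/
theorem Connected.exists_adj_adj_not_adj (hG : G.Connected) (hHG : H < G) (hH : H ≠ ⊥) :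
    ∃ v a b, H.Adj v a ∧ G.Adj v b ∧ ¬ H.Adj v b := by
  by_contra! hcon
  obtain ⟨v₀, a₀, h₀⟩ := ne_bot_iff_exists_adj.1 hH
  -- the vertices that carry an edge of `H` are closed under adjacency in `G`
  have hall : ∀ {u v} (_ : G.Walk u v), (∃ a, H.Adj u a) → ∃ a, H.Adj v a := by
    intro u v p
    induction p with
    | nil => exact id
    | cons huv _ ih => exact fun ⟨a, ha⟩ => ih ⟨_, (hcon _ _ _ ha huv).symm⟩
  refine hHG.not_ge fun u v huv => ?_
  obtain ⟨p⟩ := hG.preconnected v₀ u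
  obtain ⟨a, ha⟩ := hall p ⟨a₀, h₀⟩
  exact hcon u a v ha huv

end SimpleGraph

namespace DiffusiveNetwork

variable {V : Type*} {G : SimpleGraph V}

/-! ### Circulations in 2-connected graphs -/

section Flows

variable [DecidableEq V] (N : DiffusiveNetwork G)

theorem incidence_eq_zero {i : V} {e : G.edgeSet} (h : i ∉ (e : Sym2 V)) :
    N.incidence i e = 0 := by
  rw [← N.edge_eq e, Sym2.mem_iff, not_or] at h
  simp [incidence, h.1, h.2]

variable [Fintype G.edgeSet]

/-- An edge carries a unit flow from either of its ends to the other. -/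
theorem exists_incidence_mulVec_single {a b : V} (h : G.Adj a b) :
    ∃ c : ℝ, N.incidence.mulVec (Pi.single (⟨s(a, b), h⟩ : G.edgeSet) c) =
      Pi.single a 1 - Pi.single b 1 := by
  have hab : a ≠ b := h.ne
  have he := N.edge_eq ⟨s(a, b), h⟩
  rcases Sym2.eq_iff.1 he with ⟨h₁, h₂⟩ | ⟨h₁, h₂⟩
  · refine ⟨1, funext fun i => ?_⟩
    simp only [Matrix.mulVec_single_one, Matrix.col_apply, incidence, h₁, h₂, Pi.sub_apply,
      Pi.single_apply]
    split_ifs <;> simp_all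
  · refine ⟨-1, funext fun i => ?_⟩
    simp only [Matrix.mulVec_single, Matrix.col_apply, incidence, h₁, h₂, Pi.sub_apply,
      Pi.single_apply, Pi.smul_apply]
    split_ifs <;> simp_all

/-- A path that avoids the vertex `v` carries a unit flow that vanishes on the edges at `v`. -/
theorem exists_flow_of_reachable {v : V} {a b : ({v}ᶜ : Set V)}
    (h : (G.induce {v}ᶜ).Reachable a b) :
    ∃ f : G.edgeSet → ℝ, N.incidence.mulVec f = Pi.single (a : V) 1 - Pi.single (b : V) 1 ∧
      ∀ e : G.edgeSet, v ∈ (e : Sym2 V) → f e = 0 := by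
  obtain ⟨p⟩ := h
  induction p with
  | nil => exact ⟨0, by simp, fun _ _ => rfl⟩
  | @cons a c b hac _ ih =>
    obtain ⟨f, hf, hfv⟩ := ih
    have hac' : G.Adj (a : V) c := hac
    obtain ⟨t, ht⟩ := N.exists_incidence_mulVec_single hac'
    refine ⟨Pi.single ⟨s((a : V), c), hac'⟩ t + f, ?_, fun e hv => ?_⟩
    · rw [Matrix.mulVec_add, ht, hf, sub_add_sub_cancel]
    · have hne : e ≠ ⟨s((a : V), c), hac'⟩ := by
        rintro rfl
        rcases Sym2.mem_iff.1 hv with h | h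
        · exact a.2 h.symm
        · exact c.2 h.symm
      simp [hfv e hv, Pi.single_eq_of_ne hne]

/-- In a `2`-connected graph, the space of circulations is not invariant under the deletion of the
entries outside a nonempty proper subgraph `H`. The witness is a closed walk through a vertex `v`
that leaves `v` along an edge of `H`, returns along an edge outside `H`, and avoids `v` in
between. -/
theorem exists_circulation_mask_ne_zero (hG : IsTwoConnected G) {H : SimpleGraph V}
    (hHG : H < G) (hH : H ≠ ⊥) :
    ∃ w : G.edgeSet → ℝ, N.incidence.mulVec w = 0 ∧
      N.incidence.mulVec (maskEdges H w) ≠ 0 := by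
  obtain ⟨v, a, b, hva, hvb, hvb'⟩ := hG.1.exists_adj_adj_not_adj hHG hH
  have hva' : G.Adj v a := hHG.le hva
  obtain ⟨f, hf, hfv⟩ := N.exists_flow_of_reachable (v := v)
    (hG.2 v ⟨a, hva'.ne'⟩ ⟨b, hvb.ne'⟩)
  obtain ⟨s, hs⟩ := N.exists_incidence_mulVec_single hva'
  obtain ⟨t, ht⟩ := N.exists_incidence_mulVec_single hvb.symm
  refine ⟨Pi.single ⟨s(v, a), hva'⟩ s + f + Pi.single ⟨s(b, v), hvb.symm⟩ t, ?_, fun h => ?_⟩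
  · rw [Matrix.mulVec_add, Matrix.mulVec_add, hs, ht, hf]
    abel
  · have h₁ : maskEdges H (Pi.single (⟨s(v, a), hva'⟩ : G.edgeSet) s) =
        Pi.single (⟨s(v, a), hva'⟩ : G.edgeSet) s := by
      ext e
      by_cases he : (e : Sym2 V) ∈ H.edgeSet
      · rw [maskEdges_of_mem _ he]
      · rw [maskEdges_of_notMem _ he, Pi.single_eq_of_ne]
        rintro rfl
        exact he hva
    have h₂ : maskEdges H (Pi.single (⟨s(b, v), hvb.symm⟩ : G.edgeSet) t) = 0 := by
      ext e
      by_cases he : (e : Sym2 V) ∈ H.edgeSet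
      · rw [maskEdges_of_mem _ he, Pi.single_eq_of_ne, Pi.zero_apply]
        rintro rfl
        exact hvb' (SimpleGraph.Adj.symm he)
      · rw [maskEdges_of_notMem _ he, Pi.zero_apply]
    have h₃ : N.incidence.mulVec (maskEdges H f) v = 0 := by
      refine Finset.sum_eq_zero fun e _ => ?_
      by_cases hv : v ∈ (e : Sym2 V)
      · by_cases he : (e : Sym2 V) ∈ H.edgeSet
        · rw [maskEdges_of_mem _ he, hfv e hv, mul_zero]
        · rw [maskEdges_of_notMem _ he, mul_zero]
      · exact mul_eq_zero_of_left (N.incidence_eq_zero hv) _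
    have := congrFun h v
    rw [maskEdges_add, maskEdges_add, h₁, h₂, add_zero, Matrix.mulVec_add, hs, Pi.add_apply,
      h₃] at this
    simp [hva'.ne] at this

end Flows

/-! ### Limits of runs are steady states -/

section Passivity

variable {N : DiffusiveNetwork G}

theorem StandingAssumption.agent_isPassive (hN : N.StandingAssumption) {i : V} {u y : ℝ}
    (h : (u, y) ∈ (N.agent i).toSISO.rel) : (N.agent i).toSISO.IsPassive u y := by
  rcases hN.meip with ⟨h₁, -⟩ | ⟨h₁, -⟩
  · exact (h₁ i).1 u y h
  · exact ((h₁ i).1 u y h).isPassive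

theorem StandingAssumption.ctrl_isPassive (hN : N.StandingAssumption) {e : G.edgeSet} {u y : ℝ}
    (h : (u, y) ∈ (N.ctrl e).rel) : (N.ctrl e).IsPassive u y := by
  rcases hN.meip with ⟨-, h₁⟩ | ⟨-, h₁⟩
  · exact ((h₁ e).1 u y h).isPassive
  · exact (h₁ e).1 u y h

end Passivity

section SteadyState

variable [Fintype V] [DecidableEq V] [Fintype G.edgeSet] {N : DiffusiveNetwork G}

/-- The residual `k⁻¹(y) + E_H (γ(E_Hᵀ y) + P_H w)` of the steady-state equation of the closed loop
on `H`, for given steady-state functions `κ` (standing for `k⁻¹`) and `γ`. -/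
noncomputable def residual (N : DiffusiveNetwork G) (κ : V → ℝ → ℝ) (γ : G.edgeSet → ℝ → ℝ)
    (w : G.edgeSet → ℝ) (H : SimpleGraph V) (y : V → ℝ) : V → ℝ :=
  (fun i => κ i (y i)) +
    N.incidence.mulVec (maskEdges H ((fun e => γ e (N.incidence.transpose.mulVec y e)) + w))

theorem continuous_residual {κ : V → ℝ → ℝ} {γ : G.edgeSet → ℝ → ℝ} (hκ : ∀ i, Continuous (κ i))
    (hγ : ∀ e, Continuous (γ e)) (w : G.edgeSet → ℝ) (H : SimpleGraph V) :
    Continuous (N.residual κ γ w H) := by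
  have h₁ : Continuous fun y : V → ℝ => N.incidence.transpose.mulVec y :=
    continuous_const.matrix_mulVec continuous_id
  have h₂ : Continuous fun y : V → ℝ =>
      ((fun e => γ e (N.incidence.transpose.mulVec y e)) + w : G.edgeSet → ℝ) :=
    (continuous_pi fun e => (hγ e).comp ((continuous_apply e).comp h₁)).add continuous_const
  exact (continuous_pi fun i => (hκ i).comp (continuous_apply i)).add
    (continuous_const.matrix_mulVec ((continuous_maskEdges H).comp h₂))

/-- Power balance of the diffusive interconnection: the power supplied to agents and functioning
controllers, relative to `y'` and `Eᵀ y'`, is that of the steady-state residual at `y'`. The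
unknown controller outputs `μ` cancel. -/
theorem supply_eq_residual (κ : V → ℝ → ℝ) (γ : G.edgeSet → ℝ → ℝ) (w : G.edgeSet → ℝ)
    (H : SimpleGraph V) (x : N.AgentState) (η : N.CtrlState) (y' : V → ℝ) :
    ∑ i, (N.output x i - y' i) * (N.agentInput w H x η i - κ i (y' i)) +
      ∑ e, maskEdges H (fun e => (N.ctrlOutput x η e - γ e (N.incidence.transpose.mulVec y' e)) *
        (N.ctrlInput x e - N.incidence.transpose.mulVec y' e)) e =
      -((N.output x - y') ⬝ᵥ N.residual κ γ w H y') := by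
  set μ := N.ctrlOutput x η
  set γ' : G.edgeSet → ℝ := fun e => γ e (N.incidence.transpose.mulVec y' e) with hγ'
  set d := N.output x - y' with hd
  have h₁ : ∑ i, (N.output x i - y' i) * (N.agentInput w H x η i - κ i (y' i)) =
      -(d ⬝ᵥ N.incidence.mulVec (maskEdges H (μ + w))) - d ⬝ᵥ fun i => κ i (y' i) := by
    rw [← dotProduct_neg, ← dotProduct_sub]
    rfl
  have h₂ : ∑ e, maskEdges H (fun e => (μ e - γ e (N.incidence.transpose.mulVec y' e)) *
        (N.ctrlInput x e - N.incidence.transpose.mulVec y' e)) e =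
      d ⬝ᵥ N.incidence.mulVec (maskEdges H (μ - γ')) := by
    rw [Matrix.dotProduct_mulVec, ← Matrix.mulVec_transpose, hd, Matrix.mulVec_sub]
    refine Finset.sum_congr rfl fun e _ => ?_
    by_cases he : (e : Sym2 V) ∈ H.edgeSet
    · rw [maskEdges_of_mem _ he, maskEdges_of_mem _ he, mul_comm]
      rfl
    · rw [maskEdges_of_notMem _ he, maskEdges_of_notMem _ he, mul_zero]
  have h₃ : maskEdges H (μ + w) = maskEdges H (μ - γ') + maskEdges H (γ' + w) := by
    rw [← maskEdges_add]
    congr 1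
    abel
  rw [h₁, h₂, residual, ← hγ', dotProduct_add, h₃, Matrix.mulVec_add, dotProduct_add]
  ring

/-- If the functioning edges are eventually those of `H` and the output converges to `ystar`, then
`ystar` solves the steady-state equation of the closed loop on `H`. The sum of the storage functions
for `y'` and `Eᵀ y'` has a derivative bounded by `-(y - y') ⬝ᵥ R(y')`, where `R` is the residual, so
its nonnegativity gives `(ystar - y') ⬝ᵥ R(y') ≤ 0` for every `y'`. -/
theorem residual_eq_zero_of_tendsto (hN : N.StandingAssumption) {κ : V → ℝ → ℝ}
    {γ : G.edgeSet → ℝ → ℝ} (hκ : ∀ i, Continuous (κ i)) (hγ : ∀ e, Continuous (γ e))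
    (hκr : ∀ i y, (κ i y, y) ∈ (N.agent i).toSISO.rel) (hγr : ∀ e z, (z, γ e z) ∈ (N.ctrl e).rel)
    {w : G.edgeSet → ℝ} {ς : ℝ → SimpleGraph V} {x : ℝ → N.AgentState} {η : ℝ → N.CtrlState}
    (htraj : N.IsTrajectory w ς x η) {H : SimpleGraph V} {T : ℝ} (hT : 0 ≤ T)
    (hH : ∀ t, T ≤ t → ς t = H) {ystar : V → ℝ}
    (hlim : Tendsto (fun t => N.output (x t)) atTop (𝓝 ystar)) :
    N.residual κ γ w H ystar = 0 := by
  refine eq_zero_of_forall_sub_dotProduct_nonpos (continuous_residual hκ hγ w H) ystar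
    fun y' => ?_
  have hloc : ∀ t, T < t → ∀ᶠ s in 𝓝 t, ς s = ς t := fun t ht => by
    filter_upwards [lt_mem_nhds ht] with s hs
    rw [hH s hs.le, hH t ht.le]
  choose W hW hWd using fun i => (hN.agent_isPassive (hκr i (y' i))).exists_storage
  choose U hU hUd using fun e =>
    (hN.ctrl_isPassive (hγr e (N.incidence.transpose.mulVec y' e))).exists_storage
  have hagent : ∀ i t, T < t → ∃ d, HasDerivAt (fun s => W i (x s i)) d t ∧
      d ≤ (N.output (x t) i - y' i) * (N.agentInput w H (x t) (η t) i - κ i (y' i)) :=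
    fun i t ht => hWd i T (fun s => x s i) (fun s => N.agentInput w H (x s) (η s) i)
      (fun s hs => by
        have := htraj.agent_ode i s (hT.trans_lt hs) (hloc s hs)
        rwa [hH s hs.le] at this) t ht
  have hctrl : ∀ e t, T < t → ∃ d,
      HasDerivAt (fun s => maskEdges H (fun e => U e (η s e)) e) d t ∧
      d ≤ maskEdges H (fun e => (N.ctrlOutput (x t) (η t) e -
        γ e (N.incidence.transpose.mulVec y' e)) *
          (N.ctrlInput (x t) e - N.incidence.transpose.mulVec y' e)) e := by
    intro e t ht
    by_cases he : (e : Sym2 V) ∈ H.edgeSet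
    · simp only [maskEdges_of_mem _ he]
      refine hUd e T (fun s => η s e) (fun s => N.ctrlInput (x s) e) (fun s hs => ?_) t ht
      exact htraj.ctrl_ode e s (hT.trans_lt hs) (hloc s hs) (by rwa [hH s hs.le])
    · simp only [maskEdges_of_notMem _ he]
      exact ⟨0, hasDerivAt_const t 0, le_rfl⟩
  choose! dA hdA hdA' using hagent
  choose! dC hdC hdC' using hctrl
  have hnonneg := limit_nonneg_of_hasDerivAt_le_of_nonneg (T := T)
    (W := fun s => ∑ i, W i (x s i) + ∑ e, maskEdges H (fun e => U e (η s e)) e)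
    (W' := fun t => ∑ i, dA i t + ∑ e, dC e t)
    (g := fun t => -((N.output (x t) - y') ⬝ᵥ N.residual κ γ w H y'))
    (l := -((ystar - y') ⬝ᵥ N.residual κ γ w H y')) ?_ ?_ ?_ ?_
  · linarith
  · exact fun t ht => (HasDerivAt.fun_sum fun i _ => hdA i t ht).add
      (HasDerivAt.fun_sum fun e _ => hdC e t ht)
  · intro t ht
    rw [← supply_eq_residual κ γ w H (x t) (η t) y']
    exact add_le_add (Finset.sum_le_sum fun i _ => hdA' i t ht)
      (Finset.sum_le_sum fun e _ => hdC' e t ht)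
  · have hc : Continuous fun y : V → ℝ => -((y - y') ⬝ᵥ N.residual κ γ w H y') := by
      simp only [dotProduct]
      fun_prop
    exact (hc.tendsto ystar).comp hlim
  · refine fun t => add_nonneg (Finset.sum_nonneg fun i _ => hW i _)
      (Finset.sum_nonneg fun e _ => ?_)
    by_cases he : (e : Sym2 V) ∈ H.edgeSet
    · rw [maskEdges_of_mem _ he]
      exact hU e _
    · rw [maskEdges_of_notMem _ he]

end SteadyState

/-! ### Circulation biases -/

section Circulations

variable [DecidableEq V] [Fintype G.edgeSet] {N : DiffusiveNetwork G}

/-- A bias that is a circulation does not act on the faultless network. -/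
theorem agentInput_of_incidence_mulVec_eq_zero [Fintype V] {w : G.edgeSet → ℝ}
    (hw : N.incidence.mulVec w = 0) : N.agentInput w G = N.agentInput 0 G := by
  ext x η i
  simp only [agentInput, maskEdges_self, Matrix.mulVec_add, hw, Matrix.mulVec_zero]

/-- A run in which no switch occurs at nonnegative times, under a circulation bias, is a run of the
unbiased faultless network. -/
theorem IsTrajectory.unbias [Fintype V] {w : G.edgeSet → ℝ} (hw : N.incidence.mulVec w = 0)
    {ς : ℝ → SimpleGraph V} {x : ℝ → N.AgentState} {η : ℝ → N.CtrlState}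
    (h : N.IsTrajectory w ς x η) (hς : ∀ t, 0 ≤ t → ς t = G) :
    N.IsTrajectory 0 (fun _ => G) x η := by
  have hloc : ∀ t, 0 < t → ∀ᶠ s in 𝓝 t, ς s = ς t := fun t ht => by
    filter_upwards [lt_mem_nhds ht] with s hs
    rw [hς s hs.le, hς t ht.le]
  refine ⟨h.agent_continuous, fun i t ht _ => ?_, fun e => ?_, fun e t ht _ he => ?_⟩
  · have := h.agent_ode i t ht (hloc t ht)
    rwa [hς t ht.le, agentInput_of_incidence_mulVec_eq_zero hw] at this
  · exact (h.ctrl_continuous e).mono fun t ht => ⟨ht.1, by rw [hς t ht.1]; exact e.2⟩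
  · exact h.ctrl_ode e t ht (hloc t ht) (by rw [hς t ht.le]; exact e.2)

theorem ConvergesTo.of_incidence_mulVec_eq_zero [Fintype V] {w : G.edgeSet → ℝ}
    (hw : N.incidence.mulVec w = 0) {y : V → ℝ} (h : N.ConvergesTo 0 y) : N.ConvergesTo w y := by
  refine ⟨?_, fun x η hx => h.2 x η (hx.unbias hw fun _ _ => rfl)⟩
  obtain ⟨x, η, hy, hA, hC⟩ := h.1
  exact ⟨x, η, hy, fun i => by rw [agentInput_of_incidence_mulVec_eq_zero hw]; exact hA i, hC⟩

/-- A steady-state output of the unbiased faultless network solves its steady-state equation. -/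
theorem IsSteadyOutput.residual_eq_zero [Fintype V] {κ : V → ℝ → ℝ} {γ : G.edgeSet → ℝ → ℝ}
    (hκr : ∀ i, (N.agent i).toSISO.rel = {p | p.1 = κ i p.2})
    (hγr : ∀ e, (N.ctrl e).rel = {p | p.2 = γ e p.1}) {y : V → ℝ} (h : N.IsSteadyOutput 0 y) :
    N.residual κ γ 0 G y = 0 := by
  obtain ⟨x, η, rfl, hA, hC⟩ := h
  have hu : ∀ i, N.agentInput 0 G x η i = κ i (N.output x i) := fun i => by
    have : (N.agentInput 0 G x η i, N.output x i) ∈ (N.agent i).toSISO.rel := ⟨x i, hA i, rfl⟩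
    rwa [hκr] at this
  have hμ : N.ctrlOutput x η =
      fun e => γ e (N.incidence.transpose.mulVec (N.output x) e) := funext fun e => by
    have : (N.ctrlInput x e, N.ctrlOutput x η e) ∈ (N.ctrl e).rel := ⟨η e, hC e, rfl⟩
    rwa [hγr] at this
  rw [residual, ← hμ, ← funext hu]
  exact neg_add_cancel _

/-- Almost every circulation bias `∑ i, α i • b i` separates the steady states of the network on
`H` from those of the faultless network: for any edge vector `g`, the equation
`E_H (g + P_H w) = E_G g` holds only for `α` in a proper affine subspace. -/
theorem ae_incidence_mulVec_mask_ne (hG : IsTwoConnected G) {H : SimpleGraph V}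
    (hHG : H < G) (hH : H ≠ ⊥) {k : ℕ}
    (b : Module.Basis (Fin k) ℝ (LinearMap.ker N.incidence.mulVecLin)) (g : G.edgeSet → ℝ) :
    ∀ᵐ α : Fin k → ℝ, N.incidence.mulVec
      (maskEdges H (g + ∑ i, α i • (b i : G.edgeSet → ℝ))) ≠ N.incidence.mulVec g := by
  let L : (Fin k → ℝ) →ₗ[ℝ] V → ℝ :=
    { toFun := fun α => N.incidence.mulVec
        (maskEdges H (∑ i, α i • (b i : G.edgeSet → ℝ)))
      map_add' := fun α β => by
        simp only [Pi.add_apply, add_smul, Finset.sum_add_distrib, maskEdges_add,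
          Matrix.mulVec_add]
      map_smul' := fun c α => by
        simp only [Pi.smul_apply, smul_eq_mul, mul_smul, ← Finset.smul_sum, maskEdges_smul,
          Matrix.mulVec_smul, RingHom.id_apply] }
  set c : V → ℝ := N.incidence.mulVec g - N.incidence.mulVec (maskEdges H g) with hc
  let S : AffineSubspace ℝ (Fin k → ℝ) := (AffineSubspace.mk' c ⊥).comap L.toAffineMap
  have hmem : ∀ α, α ∈ S ↔ L α = c := fun α => by
    simp [S, AffineSubspace.mem_mk', sub_eq_zero]
  have hS : S ≠ ⊤ := by
    intro htop
    have hall : ∀ α, L α = c := fun α => (hmem α).1 (htop ▸ AffineSubspace.mem_top ℝ _ α)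
    have hc0 : c = 0 := by rw [← hall 0, map_zero]
    obtain ⟨w, hw, hw'⟩ := N.exists_circulation_mask_ne_zero hG hHG hH
    let w' : LinearMap.ker N.incidence.mulVecLin := ⟨w, by simpa using hw⟩
    have hsum : ∑ i, b.repr w' i • (b i : G.edgeSet → ℝ) = w := by
      have := congrArg (Submodule.subtype _) (b.sum_repr w')
      simpa only [map_sum, map_smul, Submodule.subtype_apply] using this
    have hLw := hall (b.repr w')
    rw [hc0] at hLw
    refine hw' ?_
    rw [← hsum]
    exact hLw
  refine (measure_eq_zero_iff_ae_notMem.1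
    (Measure.addHaar_affineSubspace volume S hS)).mono fun α hα h => hα ?_
  rw [maskEdges_add, Matrix.mulVec_add] at h
  exact (hmem α).2 (eq_sub_of_add_eq' h)

end Circulations

end DiffusiveNetwork

/-! ### Fault detection -/

/-- On a finite vertex set, a non-increasing switching signal is eventually constant, and after a
fault its final value is a nonempty proper subgraph. -/
theorem IsFaultSignal.exists_eventually_const {V : Type*} [Finite V] {G : SimpleGraph V}
    {ς : ℝ → SimpleGraph V} (h : IsFaultSignal G ς) (hfault : ∃ t, 0 ≤ t ∧ ς t ≠ G) :
    ∃ (H : SimpleGraph V) (T : ℝ), H < G ∧ H ≠ ⊥ ∧ 0 ≤ T ∧ ∀ t, T ≤ t → ς t = H := by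
  obtain ⟨t₀, ht₀, hne⟩ := hfault
  obtain ⟨_, ⟨T, hT, rfl⟩, hmin⟩ := (ς '' Ici 0).toFinite.exists_minimal
    (Set.Nonempty.image ς ⟨0, self_mem_Ici⟩)
  have hconst : ∀ t, T ≤ t → ς t = ς T := fun t ht =>
    have ht' : t ∈ Ici (0 : ℝ) := le_trans hT ht
    le_antisymm (h.antitone hT ht' ht) (hmin ⟨t, ht', rfl⟩ (h.antitone hT ht' ht))
  refine ⟨ς T, T, lt_of_le_of_ne (h.subgraph T hT) fun hTG => hne ?_, h.nonempty T hT, hT, hconst⟩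
  have hle : ς T ≤ ς t₀ := by
    rw [← hconst (max T t₀) (le_max_left _ _)]
    exact h.antitone ht₀ (le_trans ht₀ (le_max_right _ _)) (le_max_right _ _)
  exact le_antisymm (h.subgraph t₀ ht₀) (hTG ▸ hle)

/-- The steps of the algorithm: controllers that solve the synthesis problem for `G`, the agents
and `ystar` are chosen; `b` is a basis of the kernel of the incidence matrix; a Gaussian vector `α`
is drawn from the nondegenerate law `P`; the bias is `w = ∑ i, α i • b i`; and a convergence
assertion algorithm `A` for the resulting interaction protocol with limit `ystar` is used as
fault monitor. With probability one, the outcome solves the fault detection problem. -/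
theorem mainTheorem3 {V : Type*} [Fintype V] [DecidableEq V] (G : SimpleGraph V)
    [Fintype G.edgeSet] (hG : IsTwoConnected G)
    (N : DiffusiveNetwork G) (hN : N.StandingAssumption)
    (ystar : V → ℝ) (hsyn : N.SolvesSynthesis ystar)
    {k : ℕ} (b : Module.Basis (Fin k) ℝ (LinearMap.ker N.incidence.mulVecLin))
    (P : Measure (Fin k → ℝ)) [IsGaussian P] (hP : P ≪ volume)
    {M : Type*} (meas : N.AgentState → N.CtrlState → M) :
    ∀ᵐ α ∂P, ∀ A : Monitor M,
      N.IsConvergenceAssertion (∑ i, α i • (b i : G.edgeSet → ℝ)) ystar meas A →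
      N.SolvesFaultDetection (∑ i, α i • (b i : G.edgeSet → ℝ)) ystar meas A := by
  choose κ hκ _ hκr using hN.agent_rel
  choose γ hγ hγr using hN.ctrl_rel
  have hfin : ∀ᵐ α ∂P, ∀ H : SimpleGraph V, H < G → H ≠ ⊥ →
      N.incidence.mulVec (maskEdges H
        ((fun e => γ e (N.incidence.transpose.mulVec ystar e)) +
          ∑ i, α i • (b i : G.edgeSet → ℝ))) ≠
        N.incidence.mulVec (fun e => γ e (N.incidence.transpose.mulVec ystar e)) := by
    refine ae_all_iff.2 fun H => ?_
    by_cases hHG : H < G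
    · by_cases hH : H = ⊥
      · exact ae_of_all _ fun α _ hH' => absurd hH hH'
      · filter_upwards [hP.ae_le (DiffusiveNetwork.ae_incidence_mulVec_mask_ne hG hHG hH b
          fun e => γ e (N.incidence.transpose.mulVec ystar e))] with α hα _ _
        exact hα
    · exact ae_of_all _ fun α h => absurd h hHG
  filter_upwards [hfin] with α hα A hA
  have hw : N.incidence.mulVec (∑ i, α i • (b i : G.edgeSet → ℝ)) = 0 := by
    have := LinearMap.mem_ker.1 (∑ i, α i • b i).2
    simpa only [Submodule.coe_sum, Submodule.coe_smul, Matrix.mulVecLin_apply] using this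
  refine ⟨hsyn.of_incidence_mulVec_eq_zero hw, fun ς x η hς hx hςG hno => ?_,
    fun ς x η hς hx hfault => ?_⟩
  · exact (hA ς x η hς hx).1 hno (hsyn.2 x η (hx.unbias hw hςG))
  · refine (hA ς x η hς hx).2 fun hlim => ?_
    obtain ⟨H, T, hHG, hH, hT, hconst⟩ := hς.exists_eventually_const hfault
    have h₁ := DiffusiveNetwork.residual_eq_zero_of_tendsto hN
      (fun i => (hκ i).continuous) (fun e => (hγ e).continuous)
      (fun i y => by rw [hκr]; rfl) (fun e z => by rw [hγr]; rfl) hx hT hconst hlim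
    have h₀ := hsyn.1.residual_eq_zero hκr hγr
    -- the steady-state equations on `H` and on `G` share the term `k⁻¹(ystar)`
    rw [DiffusiveNetwork.residual, maskEdges_self, add_zero] at h₀
    exact hα H hHG hH (add_left_cancel (h₁.trans h₀.symm))
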